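/- Let $G$ be a finite simple graph with vertex set $V(G)$ (possibly empty), and let $\kappa(G)$ be the number of its connected components. Call $G$ *even* (respectively *odd*) if every connected component of $G$ has an even (respectively odd) number of vertices; the graph with no vertices is both even and odd, and it has $\kappa=0$. For $I\subseteq V(G)$ let $G[I]$ be the subgraph of $G$ induced by $I$. Define integers $a(G)$ and $b(G)$ recursively by $$a(G)=\begin{cases}1&\text{if }V(G)=\emptyset,\\ 0&\text{if }G\text{ is not even},\\ -\sum_{I\subsetneq V(G)}a(G[I])&\text{otherwise,}\end{cases}\qquad b(G)=\begin{cases}1&\text{if }V(G)=\emptyset,\\ 0&\text{if }G\text{ is not odd},\\ -\sum_{I\subsetneq V(G)}b(G[I])&\text{otherwise,}\end{cases}$$ where the sums run over all proper subsets $I$ of $V(G)$, including $I=\emptyset$. Then: 1. If $G$ is even, then $a(G)=(-1)^{|V(G)|/2}\,|a(G)|$. 2. If $G$ is odd, then $b(G)=(-1)^{(|V(G)|+\kappa(G))/2}\,|b(G)|$. -/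

import Mathlib

namespace SimpleGraph

universe u

/-- Every connected component has an even number of vertices. -/
def AllComponentsEven {V : Type u} (G : SimpleGraph V) : Prop :=
  ∀ C : G.ConnectedComponent, Even C.supp.ncard

/-- Every connected component has an odd number of vertices. -/
def AllComponentsOdd {V : Type u} (G : SimpleGraph V) : Prop :=
  ∀ C : G.ConnectedComponent, Odd C.supp.ncard

/-- The number of connected components of a finite graph. -/
noncomputable def numComponents {V : Type u} (G : SimpleGraph V) : ℕ :=
  Nat.card G.ConnectedComponent

/-- The graph induced on a proper subset of the vertices has fewer vertices. -/
theorem card_coe_lt_of_ssubset_univ {V : Type u} [Fintype V] (I : Finset V)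
    (hI : I ⊂ Finset.univ) : Fintype.card (I : Set V) < Fintype.card V := by
  simpa using Finset.card_lt_card hI

open Classical in
/-- The `a`-number of a finite graph. The proper induced subgraphs (the null graph among them,
when `V` is nonempty) are the graphs induced on the proper subsets `I` of the vertex set, one
summand for each `I`. -/
noncomputable def aNumber {V : Type u} [Fintype V] (G : SimpleGraph V) : ℤ :=
  if IsEmpty V then 1
  else if ¬ G.AllComponentsEven then 0
  else -∑ I : {I : Finset V // I ⊂ Finset.univ}, aNumber (G.induce (I.1 : Set V))
termination_by Fintype.card V
decreasing_by exact card_coe_lt_of_ssubset_univ I.1 I.2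

open Classical in
/-- The `b`-number of a finite graph: the same recursion, with odd graphs in place of even
ones. -/
noncomputable def bNumber {V : Type u} [Fintype V] (G : SimpleGraph V) : ℤ :=
  if IsEmpty V then 1
  else if ¬ G.AllComponentsOdd then 0
  else -∑ I : {I : Finset V // I ⊂ Finset.univ}, bNumber (G.induce (I.1 : Set V))
termination_by Fintype.card V
decreasing_by exact card_coe_lt_of_ssubset_univ I.1 I.2

end SimpleGraph

/-! Both recursions depend only on the family of vertex sets inducing connected subgraphs, so they
are studied for an arbitrary building set `B`, where the maximal members inside a set play the role
of its components. The family of a graph is moreover flag, because a connected graph on at least two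
vertices stays connected after deleting a suitable vertex.

Write a(I) for `altNumber (EvenOn B) I` and s(I) for `altSum (EvenOn B) I`. A flag building set
arises from its one-element members by inserting, one at a time, sets S = S₁ ⊔ S₂ whose halves are
already present (`exists_isSplitInsertion`). Such an insertion replaces a(I), for S ⊆ I, by a(I) -
s(S₁) s(S₂) a'(I \ S), where a' belongs to the contraction by S (`altNumber_insert`); s obeys the
same rule. Since s vanishes on members of even size, the correction matters only when both halves
are odd. Then ⌊|I|/2⌋ exceeds by one the sum of the corresponding floors for S₁, S₂ and I \ S, and
this extra sign cancels the minus. So the sign (-1)^⌊|I|/2⌋ persists, for a on every set and for s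
on members (`signPattern`).

For odd graphs, Möbius inversion identifies the b-number of I with (-1)^|I| s(I)
(`altNumber_oddOn`). As s is multiplicative over components, its sign on members gives the second
claim. -/

namespace SetSystem

/-! ### The alternating recursion on finite sets, and sums over power sets. -/

variable {α : Type*} [DecidableEq α]

open Classical in
/-- The integer-valued function on finite sets that is `1` on the empty set, vanishes on the
nonempty sets violating `E`, and sums to zero over the subsets of every nonempty set
satisfying `E`. -/
noncomputable def altNumber (E : Finset α → Prop) (I : Finset α) : ℤ :=
  if I = ∅ then 1
  else if ¬ E I then 0
  else -∑ J : {J // J ∈ I.ssubsets}, altNumber E J.1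
termination_by I.card
decreasing_by exact Finset.card_lt_card (Finset.mem_ssubsets.1 J.2)

/-- The sum of `altNumber E` over all subsets of `I`. -/
noncomputable def altSum (E : Finset α → Prop) (I : Finset α) : ℤ :=
  ∑ J ∈ I.powerset, altNumber E J

theorem altNumber_empty (E : Finset α → Prop) : altNumber E ∅ = 1 := by
  rw [altNumber]; simp

theorem altSum_empty (E : Finset α → Prop) : altSum E ∅ = 1 := by
  simp [altSum, altNumber_empty]

theorem altNumber_of_not {E : Finset α → Prop} {I : Finset α} (hI : I ≠ ∅) (h : ¬ E I) :
    altNumber E I = 0 := by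
  rw [altNumber]; simp [hI, h]

theorem altNumber_of {E : Finset α → Prop} {I : Finset α} (hI : I ≠ ∅) (h : E I) :
    altNumber E I = -∑ J ∈ I.ssubsets, altNumber E J := by
  rw [altNumber, if_neg hI, if_neg (not_not.2 h)]
  congr 1
  exact Finset.sum_coe_sort I.ssubsets (altNumber E)

theorem sum_powerset_eq_add_ssubsets (f : Finset α → ℤ) (I : Finset α) :
    ∑ J ∈ I.powerset, f J = f I + ∑ J ∈ I.ssubsets, f J := by
  rw [Finset.ssubsets, Finset.add_sum_erase _ _ (Finset.mem_powerset_self I)]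

theorem altSum_eq_zero {E : Finset α → Prop} {I : Finset α} (hI : I ≠ ∅) (h : E I) :
    altSum E I = 0 := by
  rw [altSum, sum_powerset_eq_add_ssubsets, altNumber_of hI h]; ring

/-- The recursion has a unique solution. Every later identity for `altNumber` is obtained by
checking these three conditions for a candidate `f`. -/
theorem eq_altNumber {E : Finset α → Prop} {V : Finset α} {f : Finset α → ℤ}
    (h_empty : f ∅ = 1)
    (h_not : ∀ I ⊆ V, I ≠ ∅ → ¬ E I → f I = 0)
    (h_sum : ∀ I ⊆ V, I ≠ ∅ → E I → ∑ J ∈ I.powerset, f J = 0) :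
    ∀ I ⊆ V, f I = altNumber E I := by
  intro I
  induction I using Finset.strongInduction with
  | H I ih =>
    intro hIV
    by_cases hI : I = ∅
    · rw [hI, h_empty, altNumber_empty]
    by_cases hE : E I
    · have h1 := h_sum I hIV hI hE
      rw [sum_powerset_eq_add_ssubsets] at h1
      rw [altNumber_of hI hE, ← Finset.sum_congr rfl fun J hJ =>
        ih J (Finset.mem_ssubsets.1 hJ) ((Finset.mem_ssubsets.1 hJ).1.trans hIV)]
      linarith
    · rw [h_not I hIV hI hE, altNumber_of_not hI hE]

theorem altNumber_congr {E F : Finset α → Prop} {V : Finset α}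
    (h : ∀ J ⊆ V, (E J ↔ F J)) : ∀ I ⊆ V, altNumber E I = altNumber F I :=
  eq_altNumber (altNumber_empty E)
    (fun I hI h0 hF => altNumber_of_not h0 (mt (h I hI).1 hF))
    (fun I hI h0 hF => altSum_eq_zero h0 ((h I hI).2 hF))

theorem altSum_congr {E F : Finset α → Prop} {V : Finset α}
    (h : ∀ J ⊆ V, (E J ↔ F J)) : altSum E V = altSum F V :=
  Finset.sum_congr rfl fun J hJ => altNumber_congr h J (Finset.mem_powerset.1 hJ)

theorem sum_powerset_union_mul {X Y : Finset α} (hXY : Disjoint X Y) (g h : Finset α → ℤ) :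
    ∑ J ∈ (X ∪ Y).powerset, g (J ∩ X) * h (J ∩ Y) =
      (∑ J ∈ X.powerset, g J) * ∑ J ∈ Y.powerset, h J := by
  rw [Finset.sum_mul_sum, ← Finset.sum_product']
  refine Finset.sum_nbij' (fun J => (J ∩ X, J ∩ Y)) (fun p => p.1 ∪ p.2) ?_ ?_ ?_ ?_ ?_
  · intro J _
    simp
  · rintro ⟨a, b⟩ hp
    simp only [Finset.mem_product, Finset.mem_powerset] at hp ⊢
    exact Finset.union_subset_union hp.1 hp.2
  · intro J hJ
    rw [Finset.mem_powerset] at hJ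
    simp only
    rw [← Finset.inter_union_distrib_left, Finset.inter_eq_left.2 hJ]
  · rintro ⟨a, b⟩ hp
    simp only [Finset.mem_product, Finset.mem_powerset] at hp
    rw [Finset.disjoint_left] at hXY
    ext x <;> simp only [Finset.mem_inter, Finset.mem_union]
    · have := @hp.1 x; have := @hp.2 x; have := @hXY x; tauto
    · have := @hp.1 x; have := @hp.2 x; have := @hXY x; tauto
  · intro J _
    rfl

theorem sum_powerset_superset {S I : Finset α} (hS : S ⊆ I) (g : Finset α → ℤ) :
    (∑ J ∈ I.powerset, if S ⊆ J then g (J \ S) else 0) = ∑ J ∈ (I \ S).powerset, g J := by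
  rw [← Finset.sum_filter]
  refine Finset.sum_nbij' (fun J => J \ S) (fun J => J ∪ S) ?_ ?_ ?_ ?_ ?_
  · intro J hJ
    simp only [Finset.mem_filter, Finset.mem_powerset] at hJ ⊢
    exact Finset.sdiff_subset_sdiff hJ.1 subset_rfl
  · intro J hJ
    simp only [Finset.mem_filter, Finset.mem_powerset] at hJ ⊢
    exact ⟨Finset.union_subset (hJ.trans Finset.sdiff_subset) hS, Finset.subset_union_right⟩
  · intro J hJ
    simp only [Finset.mem_filter] at hJ
    exact Finset.sdiff_union_of_subset hJ.2
  · intro J hJ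
    rw [Finset.mem_powerset] at hJ
    exact Finset.union_sdiff_cancel_right
      (Finset.disjoint_of_subset_left hJ Finset.sdiff_disjoint)
  · intro J _
    rfl

/-! ### Building sets and their components. -/

/-- `K` is a maximal member of `B` inside `I`. -/
def IsComp (B : Finset (Finset α)) (I K : Finset α) : Prop :=
  Maximal (fun K => K ∈ B ∧ K ⊆ I) K

/-- All maximal members of `B` inside `I` have even cardinality. -/
def EvenOn (B : Finset (Finset α)) (I : Finset α) : Prop :=
  ∀ K, IsComp B I K → Even K.card

/-- All maximal members of `B` inside `I` have odd cardinality. -/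
def OddOn (B : Finset (Finset α)) (I : Finset α) : Prop :=
  ∀ K, IsComp B I K → Odd K.card

/-- Building sets: families of nonempty sets closed under unions of intersecting members. -/
structure IsBuilding (B : Finset (Finset α)) : Prop where
  nonempty : ∀ K ∈ B, K.Nonempty
  union : ∀ K ∈ B, ∀ L ∈ B, (K ∩ L).Nonempty → K ∪ L ∈ B

/-- Every member with at least two elements is a disjoint union of two members. -/
def IsFlag (B : Finset (Finset α)) : Prop :=
  ∀ K ∈ B, 2 ≤ K.card → ∃ L ∈ B, ∃ M ∈ B, Disjoint L M ∧ L ∪ M = K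

theorem exists_isComp_superset {B : Finset (Finset α)} {I K : Finset α} (hK : K ∈ B)
    (hKI : K ⊆ I) : ∃ M, IsComp B I M ∧ K ⊆ M := by
  obtain ⟨M, hKM, hM⟩ := (B.filter (· ⊆ I)).exists_le_maximal
    (Finset.mem_filter.2 ⟨hK, hKI⟩)
  refine ⟨M, ?_, hKM⟩
  simpa [IsComp, Finset.mem_filter] using hM

theorem IsComp.subset_of_inter {B : Finset (Finset α)} (hB : IsBuilding B) {I K L : Finset α}
    (hK : IsComp B I K) (hL : L ∈ B) (hLI : L ⊆ I) (h : (K ∩ L).Nonempty) : L ⊆ K :=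
  Finset.subset_union_right.trans
    (hK.2 ⟨hB.union K hK.1.1 L hL h, Finset.union_subset hK.1.2 hLI⟩ Finset.subset_union_left)

theorem isComp_congr {B C : Finset (Finset α)} {I : Finset α}
    (h : ∀ K ⊆ I, (K ∈ B ↔ K ∈ C)) (K : Finset α) : IsComp B I K ↔ IsComp C I K := by
  have : (fun K => K ∈ B ∧ K ⊆ I) = fun K => K ∈ C ∧ K ⊆ I := by
    funext K
    have := h K
    simp only [eq_iff_iff]; tauto
  rw [IsComp, IsComp, this]

theorem evenOn_congr {B C : Finset (Finset α)} {I : Finset α}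
    (h : ∀ K ⊆ I, (K ∈ B ↔ K ∈ C)) : EvenOn B I ↔ EvenOn C I :=
  forall_congr' fun K => by rw [isComp_congr h K]

omit [DecidableEq α] in
theorem isComp_self {B : Finset (Finset α)} {K : Finset α} (hK : K ∈ B) : IsComp B K K :=
  ⟨⟨hK, subset_rfl⟩, fun _ h _ => h.2⟩

omit [DecidableEq α] in
theorem evenOn_of_mem {B : Finset (Finset α)} {K : Finset α} (hK : K ∈ B) :
    EvenOn B K ↔ Even K.card := by
  refine ⟨fun h => h K (isComp_self hK), fun h L hL => ?_⟩
  rwa [hL.1.2.antisymm (hL.2 ⟨hK, subset_rfl⟩ hL.1.2)]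

/-! ### Separated sets and multiplicativity. -/

/-- `X` and `Y` are disjoint and no member of `B` inside `X ∪ Y` crosses between them. -/
structure Separated (B : Finset (Finset α)) (X Y : Finset α) : Prop where
  disjoint : Disjoint X Y
  subset_or : ∀ K ∈ B, K ⊆ X ∪ Y → K ⊆ X ∨ K ⊆ Y

theorem Separated.symm {B : Finset (Finset α)} {X Y : Finset α} (h : Separated B X Y) :
    Separated B Y X :=
  ⟨h.disjoint.symm, fun K hK hs => (h.subset_or K hK (by rwa [Finset.union_comm])).symm⟩

theorem Separated.mono {B : Finset (Finset α)} {X Y X' Y' : Finset α} (h : Separated B X Y)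
    (hX : X' ⊆ X) (hY : Y' ⊆ Y) : Separated B X' Y' := by
  refine ⟨h.disjoint.mono hX hY, fun K hK hs => ?_⟩
  have hd := Finset.disjoint_left.1 h.disjoint
  rcases h.subset_or K hK (hs.trans (Finset.union_subset_union hX hY)) with h1 | h1
  · left
    intro x hx
    rcases Finset.mem_union.1 (hs hx) with h2 | h2
    · exact h2
    · exact absurd (hY h2) (hd (h1 hx))
  · right
    intro x hx
    rcases Finset.mem_union.1 (hs hx) with h2 | h2
    · exact absurd (h1 hx) (hd (hX h2))
    · exact h2

theorem Separated.isComp_left {B : Finset (Finset α)} (hB : IsBuilding B) {X Y K : Finset α}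
    (h : Separated B X Y) (hK : IsComp B X K) : IsComp B (X ∪ Y) K := by
  refine ⟨⟨hK.1.1, hK.1.2.trans Finset.subset_union_left⟩, fun L hL hKL => ?_⟩
  rcases h.subset_or L hL.1 hL.2 with h1 | h1
  · exact hK.2 ⟨hL.1, h1⟩ hKL
  · obtain ⟨x, hx⟩ := hB.nonempty K hK.1.1
    exact absurd (h1 (hKL hx)) (Finset.disjoint_left.1 h.disjoint (hK.1.2 hx))

theorem Separated.evenOn_union {B : Finset (Finset α)} (hB : IsBuilding B) {X Y : Finset α}
    (h : Separated B X Y) : EvenOn B (X ∪ Y) ↔ EvenOn B X ∧ EvenOn B Y := by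
  constructor
  · intro hE
    refine ⟨fun K hK => hE K (h.isComp_left hB hK), fun K hK => hE K ?_⟩
    rw [Finset.union_comm]
    exact h.symm.isComp_left hB hK
  · rintro ⟨hX, hY⟩ K hK
    rcases h.subset_or K hK.1.1 hK.1.2 with h1 | h1
    · exact hX K ⟨⟨hK.1.1, h1⟩, fun L hL =>
        hK.2 ⟨hL.1, hL.2.trans Finset.subset_union_left⟩⟩
    · exact hY K ⟨⟨hK.1.1, h1⟩, fun L hL =>
        hK.2 ⟨hL.1, hL.2.trans Finset.subset_union_right⟩⟩

omit [DecidableEq α] in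
theorem evenOn_empty (B : Finset (Finset α)) : EvenOn B ∅ := by
  intro K hK
  rw [Finset.subset_empty.1 hK.1.2]
  simp

theorem altNumber_evenOn_of_not {B : Finset (Finset α)} {I : Finset α}
    (h : ¬ EvenOn B I) : altNumber (EvenOn B) I = 0 :=
  altNumber_of_not (fun h0 => h (h0 ▸ evenOn_empty B)) h

/-- The product satisfies the same recursion: its sum over subsets of `I` factors, and for nonempty
even `I` at least one of the two traces is nonempty and even, so its factor vanishes. -/
theorem Separated.altNumber_eq_mul {B : Finset (Finset α)} (hB : IsBuilding B)
    {X Y : Finset α} (h : Separated B X Y) :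
    ∀ I ⊆ X ∪ Y, altNumber (EvenOn B) (I ∩ X) * altNumber (EvenOn B) (I ∩ Y) =
      altNumber (EvenOn B) I := by
  have hun : ∀ I ⊆ X ∪ Y, (I ∩ X) ∪ (I ∩ Y) = I := fun I hI => by
    rw [← Finset.inter_union_distrib_left, Finset.inter_eq_left.2 hI]
  have hsep : ∀ I, Separated B (I ∩ X) (I ∩ Y) := fun I =>
    h.mono Finset.inter_subset_right Finset.inter_subset_right
  refine eq_altNumber ?_ ?_ ?_
  · simp [altNumber_empty]
  · intro I hI _ hE
    rw [← hun I hI, (hsep I).evenOn_union hB, not_and_or] at hE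
    rcases hE with hE | hE <;> rw [altNumber_evenOn_of_not hE] <;> simp
  · intro I hI h0 hE
    rw [← hun I hI, (hsep I).evenOn_union hB] at hE
    have key := sum_powerset_union_mul (hsep I).disjoint (altNumber (EvenOn B))
      (altNumber (EvenOn B))
    rw [hun I hI] at key
    have h1 : ∑ J ∈ I.powerset,
        altNumber (EvenOn B) (J ∩ X) * altNumber (EvenOn B) (J ∩ Y) =
        altSum (EvenOn B) (I ∩ X) * altSum (EvenOn B) (I ∩ Y) := by
      rw [altSum, altSum, ← key]
      refine Finset.sum_congr rfl fun J hJ => ?_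
      rw [Finset.mem_powerset] at hJ
      rw [← Finset.inter_assoc, ← Finset.inter_assoc, Finset.inter_eq_left.2 hJ]
    rw [h1]
    by_cases hX : I ∩ X = ∅
    · have hY : I ∩ Y ≠ ∅ := fun hY => h0 (by rw [← hun I hI, hX, hY]; simp)
      rw [altSum_eq_zero hY hE.2, mul_zero]
    · rw [altSum_eq_zero hX hE.1, zero_mul]

theorem Separated.altSum_union {B : Finset (Finset α)} (hB : IsBuilding B)
    {X Y : Finset α} (h : Separated B X Y) :
    altSum (EvenOn B) (X ∪ Y) = altSum (EvenOn B) X * altSum (EvenOn B) Y := by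
  rw [altSum, altSum, altSum, ← sum_powerset_union_mul h.disjoint]
  exact Finset.sum_congr rfl fun J hJ => (h.altNumber_eq_mul hB J (Finset.mem_powerset.1 hJ)).symm

/-! ### Contraction of building sets. -/

/-- The contraction of the family `B` by `S`. -/
def contract (B : Finset (Finset α)) (S : Finset α) : Finset (Finset α) :=
  (B.filter (fun K => ¬ K ⊆ S)).image (· \ S)

theorem mem_contract {B : Finset (Finset α)} {S L : Finset α} :
    L ∈ contract B S ↔ ∃ K ∈ B, ¬ K ⊆ S ∧ K \ S = L := by
  simp [contract, and_assoc]

theorem IsBuilding.contract {B : Finset (Finset α)} (hB : IsBuilding B) (S : Finset α) :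
    IsBuilding (contract B S) := by
  constructor
  · intro L hL
    obtain ⟨K, _, hKS, rfl⟩ := mem_contract.1 hL
    exact Finset.sdiff_nonempty.2 hKS
  · intro L hL M hM h
    obtain ⟨K, hK, hKS, rfl⟩ := mem_contract.1 hL
    obtain ⟨N, hN, _, rfl⟩ := mem_contract.1 hM
    refine mem_contract.2 ⟨K ∪ N, hB.union K hK N hN ?_, ?_, ?_⟩
    · exact h.mono (Finset.inter_subset_inter Finset.sdiff_subset Finset.sdiff_subset)
    · exact fun h => hKS (Finset.subset_union_left.trans h)
    · exact Finset.union_sdiff_distrib K N S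

/-- Split `K` repeatedly. While one half lies in `S`, the other half has the same trace outside `S`;
once neither does, the two traces are the required halves. -/
theorem IsFlag.contract {B : Finset (Finset α)} (hB : IsBuilding B) (hF : IsFlag B)
    (S : Finset α) : IsFlag (contract B S) := by
  suffices H : ∀ n, ∀ K ∈ B, K.card = n → ¬ K ⊆ S → 2 ≤ (K \ S).card →
      ∃ L ∈ SetSystem.contract B S, ∃ M ∈ SetSystem.contract B S,
        Disjoint L M ∧ L ∪ M = K \ S by
    intro L hL hc
    obtain ⟨K, hK, hKS, rfl⟩ := mem_contract.1 hL
    exact H _ K hK rfl hKS hc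
  intro n
  induction n using Nat.strong_induction_on with
  | _ n ih =>
    rintro K hK rfl hKS hc
    obtain ⟨L, hL, M, hM, hd, rfl⟩ :=
      hF K hK (hc.trans (Finset.card_le_card Finset.sdiff_subset))
    have hcard := Finset.card_union_of_disjoint hd
    have hL0 := (hB.nonempty L hL).card_pos
    have hM0 := (hB.nonempty M hM).card_pos
    rw [Finset.union_sdiff_distrib] at hc ⊢
    by_cases hLS : L ⊆ S
    · have e : L \ S = ∅ := Finset.sdiff_eq_empty_iff_subset.2 hLS
      rw [e, Finset.empty_union] at hc ⊢
      exact ih M.card (by omega) M hM rfl (fun h => hKS (Finset.union_subset hLS h)) hc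
    by_cases hMS : M ⊆ S
    · have e : M \ S = ∅ := Finset.sdiff_eq_empty_iff_subset.2 hMS
      rw [e, Finset.union_empty] at hc ⊢
      exact ih L.card (by omega) L hL rfl hLS hc
    exact ⟨_, mem_contract.2 ⟨L, hL, hLS, rfl⟩, _, mem_contract.2 ⟨M, hM, hMS, rfl⟩,
      hd.mono Finset.sdiff_subset Finset.sdiff_subset, rfl⟩

/-- The component containing `S` loses an even number of elements, or disappears if it is `S`
itself; the other components are untouched. -/
theorem evenOn_contract {B : Finset (Finset α)} (hB : IsBuilding B) {S I : Finset α}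
    (hS : S ∈ B) (hSI : S ⊆ I) (hev : Even S.card) :
    EvenOn (contract B S) (I \ S) ↔ EvenOn B I := by
  have hpar : ∀ K, IsComp B I K → (Even (K \ S).card ↔ Even K.card) := by
    intro K hK
    by_cases h : (K ∩ S).Nonempty
    · have hSK := hK.subset_of_inter hB hS hSI h
      rw [← Finset.card_sdiff_add_card_eq_card hSK, Nat.even_add]
      tauto
    · rw [Finset.not_nonempty_iff_eq_empty, ← Finset.disjoint_iff_inter_eq_empty] at h
      rw [Finset.sdiff_eq_self_of_disjoint h]
  have hsub : ∀ K, K \ S ⊆ I \ S → K ⊆ I := fun K h x hx => by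
    by_cases hxS : x ∈ S
    · exact hSI hxS
    · exact (Finset.mem_sdiff.1 (h (Finset.mem_sdiff.2 ⟨hx, hxS⟩))).1
  constructor
  · intro hE K hK
    rw [← hpar K hK]
    by_cases hKS : K ⊆ S
    · simp [Finset.sdiff_eq_empty_iff_subset.2 hKS]
    · refine hE _ ⟨⟨mem_contract.2 ⟨K, hK.1.1, hKS, rfl⟩,
        Finset.sdiff_subset_sdiff hK.1.2 subset_rfl⟩, ?_⟩
      rintro L ⟨hL, hLI⟩ hKL
      obtain ⟨N, hN, hNS, rfl⟩ := mem_contract.1 hL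
      refine Finset.sdiff_subset_sdiff (hK.subset_of_inter hB hN (hsub N hLI) ?_) subset_rfl
      obtain ⟨x, hx⟩ := Finset.sdiff_nonempty.2 hKS
      exact ⟨x, Finset.mem_inter.2 ⟨(Finset.mem_sdiff.1 hx).1,
        (Finset.mem_sdiff.1 (hKL hx)).1⟩⟩
  · intro hE L hL
    obtain ⟨K, hK, hKS, rfl⟩ := mem_contract.1 hL.1.1
    obtain ⟨M, hM, hKM⟩ := exists_isComp_superset hK (hsub K hL.1.2)
    have h1 : K \ S ⊆ M \ S := Finset.sdiff_subset_sdiff hKM subset_rfl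
    have h2 : M \ S ⊆ K \ S :=
      hL.2 ⟨mem_contract.2 ⟨M, hM.1.1, fun h => hKS (hKM.trans h), rfl⟩,
        Finset.sdiff_subset_sdiff hM.1.2 subset_rfl⟩ h1
    rw [h1.antisymm h2, hpar M hM]
    exact hE M hM

/-! ### Inserting one set into a building set. -/

/-- `S` is a new set, splitting into the members `S₁` and `S₂` of the building set `B`,
such that `insert S B` is again a building set. -/
structure IsSplitInsertion (B : Finset (Finset α)) (S S₁ S₂ : Finset α) : Prop where
  building : IsBuilding B
  building_insert : IsBuilding (insert S B)
  notMem : S ∉ B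
  left_mem : S₁ ∈ B
  right_mem : S₂ ∈ B
  disjoint : Disjoint S₁ S₂
  union_eq : S₁ ∪ S₂ = S

namespace IsSplitInsertion

variable {B : Finset (Finset α)} {S S₁ S₂ : Finset α}

/-- A member inside `S` meeting both halves would, by closure under unions, force `S` itself into
`B`. -/
theorem separated (h : IsSplitInsertion B S S₁ S₂) : Separated B S₁ S₂ := by
  refine ⟨h.disjoint, fun K hK hKS => ?_⟩
  by_contra hcon
  rw [not_or, Finset.not_subset, Finset.not_subset] at hcon
  obtain ⟨⟨x, hxK, hx⟩, y, hyK, hy⟩ := hcon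
  have hx2 : x ∈ S₂ := (Finset.mem_union.1 (hKS hxK)).resolve_left hx
  have hy1 : y ∈ S₁ := (Finset.mem_union.1 (hKS hyK)).resolve_right hy
  have h1 := h.building.union K hK S₁ h.left_mem ⟨y, Finset.mem_inter.2 ⟨hyK, hy1⟩⟩
  have h2 := h.building.union _ h1 S₂ h.right_mem
    ⟨x, Finset.mem_inter.2 ⟨Finset.mem_union_left _ hxK, hx2⟩⟩
  rw [Finset.union_assoc, Finset.union_eq_right.2 hKS, h.union_eq] at h2
  exact h.notMem h2

theorem card_eq (h : IsSplitInsertion B S S₁ S₂) : S.card = S₁.card + S₂.card := by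
  rw [← h.union_eq, Finset.card_union_of_disjoint h.disjoint]

theorem nonempty (h : IsSplitInsertion B S S₁ S₂) : S.Nonempty :=
  h.building_insert.nonempty S (Finset.mem_insert_self S B)

theorem evenOn_iff_of_not_subset {I : Finset α} (hSI : ¬ S ⊆ I) :
    EvenOn (insert S B) I ↔ EvenOn B I := by
  refine evenOn_congr fun K hK => ?_
  rw [Finset.mem_insert, or_iff_right]
  rintro rfl
  exact hSI hK

theorem not_subset_of_disjoint (h : IsSplitInsertion B S S₁ S₂) {J : Finset α}
    (hJ : Disjoint S J) : ¬ S ⊆ J := by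
  intro hs
  exact h.nonempty.ne_empty (disjoint_self.1 (hJ.mono_right hs))

theorem isComp_iff_of_not_isComp {I : Finset α} (hS : ¬ IsComp (insert S B) I S) (K : Finset α) :
    IsComp (insert S B) I K ↔ IsComp B I K := by
  constructor
  · intro hK
    have hne : K ≠ S := fun e => hS (e ▸ hK)
    exact ⟨⟨(Finset.mem_insert.1 hK.1.1).resolve_left hne, hK.1.2⟩,
      fun L hL => hK.2 ⟨Finset.mem_insert_of_mem hL.1, hL.2⟩⟩
  · intro hK
    refine ⟨⟨Finset.mem_insert_of_mem hK.1.1, hK.1.2⟩, ?_⟩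
    rintro L ⟨hL, hLI⟩ hKL
    obtain ⟨M, hM, hLM⟩ := exists_isComp_superset hL hLI
    have hne : M ≠ S := fun e => hS (e ▸ hM)
    exact hLM.trans (hK.2 ⟨(Finset.mem_insert.1 hM.1.1).resolve_left hne, hM.1.2⟩
      (hKL.trans hLM))

theorem _root_.SetSystem.IsComp.separated {I : Finset α} (hB : IsBuilding B)
    (hS : IsComp B I S) : Separated B S (I \ S) := by
  refine ⟨Finset.disjoint_sdiff, fun K hK hKI => ?_⟩
  rw [Finset.union_sdiff_of_subset hS.1.2] at hKI
  by_cases h : (S ∩ K).Nonempty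
  · exact Or.inl (hS.subset_of_inter hB hK hKI h)
  · right
    rw [Finset.not_nonempty_iff_eq_empty, ← Finset.disjoint_iff_inter_eq_empty] at h
    exact Finset.subset_sdiff.2 ⟨hKI, h.symm⟩

theorem separated_of_isComp (h : IsSplitInsertion B S S₁ S₂) {I : Finset α}
    (hS : IsComp (insert S B) I S) : Separated B S (I \ S) :=
  have hs := hS.separated h.building_insert
  ⟨hs.disjoint, fun K hK => hs.subset_or K (Finset.mem_insert_of_mem hK)⟩

theorem evenOn_iff_of_isComp (h : IsSplitInsertion B S S₁ S₂) {I : Finset α}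
    (hS : IsComp (insert S B) I S) :
    EvenOn B I ↔ (Even S₁.card ∧ Even S₂.card) ∧ EvenOn B (I \ S) := by
  conv_lhs => rw [← Finset.union_sdiff_of_subset hS.1.2]
  rw [(h.separated_of_isComp hS).evenOn_union h.building, ← evenOn_of_mem h.left_mem,
    ← evenOn_of_mem h.right_mem, ← h.separated.evenOn_union h.building, h.union_eq]

theorem evenOn_insert_iff_of_isComp (h : IsSplitInsertion B S S₁ S₂) {I : Finset α}
    (hS : IsComp (insert S B) I S) :
    EvenOn (insert S B) I ↔ Even S.card ∧ EvenOn B (I \ S) := by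
  conv_lhs => rw [← Finset.union_sdiff_of_subset hS.1.2]
  rw [(hS.separated h.building_insert).evenOn_union h.building_insert,
    evenOn_of_mem (Finset.mem_insert_self S B),
    evenOn_iff_of_not_subset (h.not_subset_of_disjoint Finset.disjoint_sdiff)]

theorem evenOn_insert_of_evenOn (h : IsSplitInsertion B S S₁ S₂) {I : Finset α}
    (hE : EvenOn B I) : EvenOn (insert S B) I := by
  by_cases hSI : S ⊆ I
  · by_cases hS : IsComp (insert S B) I S
    · rw [h.evenOn_iff_of_isComp hS] at hE
      rw [h.evenOn_insert_iff_of_isComp hS, h.card_eq]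
      exact ⟨hE.1.1.add hE.1.2, hE.2⟩
    · exact fun K hK => hE K ((isComp_iff_of_not_isComp hS K).1 hK)
  · exact (evenOn_iff_of_not_subset hSI).2 hE

/-- A member of `B` is its own only component, so `altSum` vanishes on it when its size is even. -/
theorem altSum_mul_eq_zero_or (h : IsSplitInsertion B S S₁ S₂) :
    altSum (EvenOn B) S₁ * altSum (EvenOn B) S₂ = 0 ∨ Odd S₁.card ∧ Odd S₂.card := by
  rw [← Nat.not_even_iff_odd, ← Nat.not_even_iff_odd]
  by_cases h1 : Even S₁.card
  · left
    rw [altSum_eq_zero (h.building.nonempty _ h.left_mem).ne_empty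
      ((evenOn_of_mem h.left_mem).2 h1), zero_mul]
  by_cases h2 : Even S₂.card
  · left
    rw [altSum_eq_zero (h.building.nonempty _ h.right_mem).ne_empty
      ((evenOn_of_mem h.right_mem).2 h2), mul_zero]
  exact Or.inr ⟨h1, h2⟩

theorem evenOn_contract (h : IsSplitInsertion B S S₁ S₂) {I : Finset α} (hSI : S ⊆ I)
    (hodd : Odd S₁.card ∧ Odd S₂.card) :
    EvenOn (contract (insert S B) S) (I \ S) ↔ EvenOn (insert S B) I :=
  SetSystem.evenOn_contract h.building_insert (Finset.mem_insert_self S B) hSI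
    (by rw [h.card_eq]; exact hodd.1.add_odd hodd.2)

/-- When `S` is a component of `I`, no member inside `I` crosses from `S` to `I \ S`, so contraction
leaves the members inside `I \ S` unchanged. -/
theorem altSum_contract_of_isComp (h : IsSplitInsertion B S S₁ S₂) {I : Finset α}
    (hS : IsComp (insert S B) I S) :
    altSum (EvenOn (contract (insert S B) S)) (I \ S) = altSum (EvenOn B) (I \ S) := by
  refine altSum_congr fun J hJ => evenOn_congr fun K hK => ?_
  have hsep := h.separated_of_isComp hS
  have hKI := hK.trans hJ
  rw [mem_contract]
  constructor
  · rintro ⟨L, hL, hLS, rfl⟩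
    have hLB : L ∈ B := (Finset.mem_insert.1 hL).resolve_left fun e => hLS e.subset
    have hL1 : L ⊆ I \ S := (hsep.subset_or L hLB fun x hx => by
      by_cases hxS : x ∈ S
      · exact Finset.mem_union_left _ hxS
      · exact Finset.mem_union_right _ (hKI (Finset.mem_sdiff.2 ⟨hx, hxS⟩))).resolve_left hLS
    rwa [Finset.sdiff_eq_self_of_disjoint (Finset.disjoint_sdiff.mono_right hL1).symm]
  · intro hKB
    have hd : Disjoint K S := (Finset.disjoint_sdiff.mono_right hKI).symm
    refine ⟨K, Finset.mem_insert_of_mem hKB, fun hs => ?_, Finset.sdiff_eq_self_of_disjoint hd⟩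
    exact (h.building.nonempty K hKB).ne_empty (disjoint_self.1 (hd.mono_right hs))

theorem sum_powerset_eq (I : Finset α) :
    ∑ J ∈ I.powerset, (altNumber (EvenOn B) J - if S ⊆ J then
      altSum (EvenOn B) S₁ * altSum (EvenOn B) S₂ *
        altNumber (EvenOn (contract (insert S B) S)) (J \ S) else 0) =
    altSum (EvenOn B) I - if S ⊆ I then altSum (EvenOn B) S₁ * altSum (EvenOn B) S₂ *
        altSum (EvenOn (contract (insert S B) S)) (I \ S) else 0 := by
  rw [Finset.sum_sub_distrib]
  congr 1
  split_ifs with hSI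
  · exact (sum_powerset_superset hSI fun J => altSum (EvenOn B) S₁ * altSum (EvenOn B) S₂ *
      altNumber (EvenOn (contract (insert S B) S)) J).trans (Finset.mul_sum _ _ _).symm
  · refine Finset.sum_eq_zero fun J hJ => if_neg fun hSJ => hSI ?_
    exact hSJ.trans (Finset.mem_powerset.1 hJ)

/-- The right-hand side satisfies the recursion for `insert S B`. The coefficient is the one that
makes its sums over subsets vanish on sets that are even only after the insertion. -/
theorem altNumber_insert (h : IsSplitInsertion B S S₁ S₂) (I : Finset α) :
    altNumber (EvenOn (insert S B)) I = altNumber (EvenOn B) I - if S ⊆ I then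
      altSum (EvenOn B) S₁ * altSum (EvenOn B) S₂ *
        altNumber (EvenOn (contract (insert S B) S)) (I \ S) else 0 := by
  refine (eq_altNumber (V := I) (f := fun I => altNumber (EvenOn B) I - if S ⊆ I then
      altSum (EvenOn B) S₁ * altSum (EvenOn B) S₂ *
        altNumber (EvenOn (contract (insert S B) S)) (I \ S) else 0)
      ?_ ?_ ?_ I subset_rfl).symm
  · simp [h.nonempty.ne_empty, altNumber_empty]
  · intro I _ _ hE
    rw [altNumber_evenOn_of_not (mt h.evenOn_insert_of_evenOn hE)]
    split_ifs with hSI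
    · rcases h.altSum_mul_eq_zero_or with h0 | hodd
      · rw [h0]; ring
      · rw [← h.evenOn_contract hSI hodd] at hE
        rw [altNumber_evenOn_of_not hE]; ring
    · ring
  · intro I _ h0 hE
    rw [sum_powerset_eq]
    split_ifs with hSI
    · by_cases hEB : EvenOn B I
      · rw [altSum_eq_zero h0 hEB]
        rcases h.altSum_mul_eq_zero_or with hz | hodd
        · rw [hz]; ring
        · rw [← h.evenOn_contract hSI hodd] at hE
          rw [altSum_eq_zero _ hE]
          · ring
          -- If `I = S`, the odd set `S₁` would be a component of `I` in `B`, contradicting `hEB`.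
          · intro he
            have hIS : I = S := (Finset.sdiff_eq_empty_iff_subset.1 he).antisymm hSI
            rw [hIS, ← h.union_eq, h.separated.evenOn_union h.building,
              evenOn_of_mem h.left_mem] at hEB
            exact (Nat.not_even_iff_odd.2 hodd.1) hEB.1
      -- Evenness has changed, so `S` must be a component of `I` after the insertion. Both terms
      -- then equal the product of the sums over `S₁`, `S₂` and `I \ S`.
      · have hS : IsComp (insert S B) I S := by
          by_contra hS
          exact hEB fun K hK => hE K ((isComp_iff_of_not_isComp hS K).2 hK)
        rw [h.altSum_contract_of_isComp hS, ← h.separated.altSum_union h.building, h.union_eq,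
          ← (h.separated_of_isComp hS).altSum_union h.building,
          Finset.union_sdiff_of_subset hSI, sub_self]
    · rw [altSum_eq_zero h0 ((evenOn_iff_of_not_subset hSI).1 hE), sub_zero]

theorem altSum_insert (h : IsSplitInsertion B S S₁ S₂) (I : Finset α) :
    altSum (EvenOn (insert S B)) I = altSum (EvenOn B) I - if S ⊆ I then
      altSum (EvenOn B) S₁ * altSum (EvenOn B) S₂ *
        altSum (EvenOn (contract (insert S B) S)) (I \ S) else 0 := by
  rw [← sum_powerset_eq, altSum]
  exact Finset.sum_congr rfl fun J _ => h.altNumber_insert J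

end IsSplitInsertion

/-! ### Propagation of signs. -/

/-- The sign pattern of the numbers attached to `B` on the set `V`. -/
structure SignPattern (B : Finset (Finset α)) (V : Finset α) : Prop where
  altNumber_nonneg : 0 ≤ (-1) ^ (V.card / 2) * altNumber (EvenOn B) V
  altSum_nonneg : V ∈ B → 0 ≤ (-1) ^ (V.card / 2) * altSum (EvenOn B) V

theorem IsSplitInsertion.signPattern {B : Finset (Finset α)} {S S₁ S₂ V : Finset α}
    (h : IsSplitInsertion B S S₁ S₂) (hV : SignPattern B V) (h₁ : S ⊆ V → SignPattern B S₁)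
    (h₂ : S ⊆ V → SignPattern B S₂)
    (hC : S ⊆ V → SignPattern (contract (insert S B) S) (V \ S)) :
    SignPattern (insert S B) V := by
  by_cases hSV : S ⊆ V
  swap
  · constructor
    · rw [h.altNumber_insert, if_neg hSV, sub_zero]; exact hV.1
    · intro hm
      rw [h.altSum_insert, if_neg hSV, sub_zero]
      exact hV.2 ((Finset.mem_insert.1 hm).resolve_left fun e => hSV e.symm.subset)
  have key : ∀ x y : ℤ, 0 ≤ (-1) ^ (V.card / 2) * x → 0 ≤ (-1) ^ ((V \ S).card / 2) * y →
      0 ≤ (-1) ^ (V.card / 2) *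
        (x - altSum (EvenOn B) S₁ * altSum (EvenOn B) S₂ * y) := by
    intro x y hx hy
    rcases h.altSum_mul_eq_zero_or with h0 | hodd
    · rw [h0, zero_mul, sub_zero]; exact hx
    -- Each odd half loses 1/2 to rounding, whence the `+ 1`; it turns the subtraction below into an
    -- addition.
    · have hc : V.card / 2 = S₁.card / 2 + S₂.card / 2 + (V \ S).card / 2 + 1 := by
        have e1 := Finset.card_sdiff_add_card_eq_card hSV
        have e2 := h.card_eq
        obtain ⟨⟨a, ha⟩, b, hb⟩ := hodd
        omega
      have hp := mul_nonneg (mul_nonneg ((h₁ hSV).2 h.left_mem) ((h₂ hSV).2 h.right_mem)) hy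
      have e : (-1 : ℤ) ^ (V.card / 2) *
          (x - altSum (EvenOn B) S₁ * altSum (EvenOn B) S₂ * y) =
          (-1) ^ (V.card / 2) * x + (-1) ^ (S₁.card / 2) * altSum (EvenOn B) S₁ *
            ((-1) ^ (S₂.card / 2) * altSum (EvenOn B) S₂) *
            ((-1) ^ ((V \ S).card / 2) * y) := by
        rw [mul_sub, sub_eq_add_neg, hc]
        simp only [pow_add, pow_one]
        ring
      rw [e]
      exact add_nonneg hx hp
  constructor
  · rw [h.altNumber_insert, if_pos hSV]
    exact key _ _ hV.1 (hC hSV).1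
  · intro hm
    rcases Finset.mem_insert.1 hm with rfl | hm
    -- Here the set is `S` itself: multiplicativity over the two halves makes the correction equal
    -- to the old sum, so the new sum is 0.
    · rw [h.altSum_insert, if_pos subset_rfl, Finset.sdiff_self, altSum_empty, mul_one,
        ← h.separated.altSum_union h.building, h.union_eq, sub_self, mul_zero]
    · rw [h.altSum_insert, if_pos hSV]
      refine key _ _ (hV.2 hm) ((hC hSV).2 (mem_contract.2
        ⟨V, Finset.mem_insert_of_mem hm, fun hs => h.notMem ?_, rfl⟩))
      rwa [hSV.antisymm hs]

/-- The starting family: all components are single points, hence odd, so only the empty set has a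
nonzero number. -/
theorem signPattern_of_card_eq_one {B : Finset (Finset α)} {V : Finset α}
    (hB : ∀ K ∈ B, K.card = 1) (hV : ∀ x ∈ V, {x} ∈ B) : SignPattern B V := by
  have hn : ∀ x ∈ V, altNumber (EvenOn B) V = 0 := fun x hx => by
    refine altNumber_of_not (Finset.ne_empty_of_mem hx) fun hE => ?_
    have h1 := hE {x} ⟨⟨hV x hx, Finset.singleton_subset_iff.2 hx⟩, fun L hL hxL =>
      (Finset.eq_of_subset_of_card_le hxL (by rw [hB L hL.1]; simp)).symm.subset⟩
    simp at h1
  constructor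
  · rcases V.eq_empty_or_nonempty with rfl | ⟨x, hx⟩
    · simp [altNumber_empty]
    · rw [hn x hx, mul_zero]
  · intro hVB
    obtain ⟨x, rfl⟩ := Finset.card_eq_one.1 (hB V hVB)
    rw [altSum, ← insert_empty_eq, Finset.sum_powerset_insert (Finset.notMem_empty x),
      Finset.powerset_empty, Finset.sum_singleton, Finset.sum_singleton, insert_empty_eq,
      hn x (Finset.mem_singleton_self x), altNumber_empty]
    simp

/-! ### Growing a flag building set from its singletons. -/

/-- A flag building set that is not the whole flag building set `B` can be enlarged inside `B`
by one set. -/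
theorem exists_isSplitInsertion {A B : Finset (Finset α)} (hB : IsBuilding B) (hFB : IsFlag B)
    (hA : IsBuilding A) (hAB : A ⊂ B) (hone : ∀ K ∈ B, K.card = 1 → K ∈ A) :
    ∃ S ∈ B, ∃ S₁ S₂, IsSplitInsertion A S S₁ S₂ := by
  classical
  -- The candidates for insertion. A smallest missing set is one, since its halves in `B` are
  -- smaller and hence lie in `A`; a largest candidate is the one that keeps closure under unions.
  set N := (B \ A).filter fun S => ∃ S₁ ∈ A, ∃ S₂ ∈ A, Disjoint S₁ S₂ ∧ S₁ ∪ S₂ = S with hN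
  have hne : N.Nonempty := by
    have hBA : (B \ A).Nonempty := Finset.sdiff_nonempty.2 (not_subset_of_ssubset hAB)
    obtain ⟨K, hK, hmin⟩ := Finset.exists_min_image (B \ A) Finset.card hBA
    rw [Finset.mem_sdiff] at hK
    have h0 := (hB.nonempty K hK.1).card_pos
    have h1 : K.card ≠ 1 := fun h => hK.2 (hone K hK.1 h)
    obtain ⟨L, hL, M, hM, hd, hu⟩ := hFB K hK.1 (by omega)
    have hc := Finset.card_union_of_disjoint hd
    rw [hu] at hc
    have hL0 := (hB.nonempty L hL).card_pos
    have hM0 := (hB.nonempty M hM).card_pos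
    refine ⟨K, Finset.mem_filter.2 ⟨Finset.mem_sdiff.2 hK, L, ?_, M, ?_, hd, hu⟩⟩
    · by_contra hLA
      have := hmin L (Finset.mem_sdiff.2 ⟨hL, hLA⟩)
      omega
    · by_contra hMA
      have := hmin M (Finset.mem_sdiff.2 ⟨hM, hMA⟩)
      omega
  obtain ⟨S, hS, hmax⟩ := Finset.exists_max_image N Finset.card hne
  rw [hN, Finset.mem_filter, Finset.mem_sdiff] at hS
  obtain ⟨⟨hSB, hSA⟩, S₁, hS₁, S₂, hS₂, hd, hu⟩ := hS
  -- If `T` meets only the half `P`, then `T ∪ S` splits into `T ∪ P` and `Q`, both in `A`. Were it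
  -- missing from `A`, it would be a candidate larger than `S`.
  have half : ∀ P ∈ A, ∀ Q ∈ A, Disjoint P Q → P ∪ Q = S → ∀ T ∈ A, (T ∩ P).Nonempty →
      Disjoint T Q → T ∪ S = S ∨ T ∪ S ∈ A := by
    intro P hP Q hQ hPQ hPQS T hT hTP hTQ
    by_cases hTS : T ⊆ S
    · exact Or.inl (Finset.union_eq_right.2 hTS)
    right
    by_contra hcon
    have h1 : T ∪ P ∈ A := hA.union T hT P hP hTP
    have h2 : T ∪ S ∈ N := by
      refine Finset.mem_filter.2 ⟨Finset.mem_sdiff.2 ⟨?_, hcon⟩, T ∪ P, h1, Q, hQ,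
        Finset.disjoint_union_left.2 ⟨hTQ, hPQ⟩, by rw [Finset.union_assoc, hPQS]⟩
      refine hB.union T (hAB.1 hT) S hSB (hTP.mono ?_)
      exact Finset.inter_subset_inter_left (hPQS ▸ Finset.subset_union_left)
    have h3 := hmax _ h2
    exact hTS (Finset.union_eq_right.1
      (Finset.eq_of_subset_of_card_le Finset.subset_union_right h3).symm)
  have cross : ∀ T ∈ A, (T ∩ S).Nonempty → T ∪ S = S ∨ T ∪ S ∈ A := by
    intro T hT hTS
    by_cases h1 : (T ∩ S₁).Nonempty
    · by_cases h2 : (T ∩ S₂).Nonempty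
      · right
        have h3 := hA.union T hT S₁ hS₁ h1
        have h4 := hA.union _ h3 S₂ hS₂
          (h2.mono (Finset.inter_subset_inter_right Finset.subset_union_left))
        rwa [Finset.union_assoc, hu] at h4
      · rw [Finset.not_nonempty_iff_eq_empty, ← Finset.disjoint_iff_inter_eq_empty] at h2
        exact half S₁ hS₁ S₂ hS₂ hd hu T hT h1 h2
    · have h2 : (T ∩ S₂).Nonempty := by
        rw [← hu, Finset.inter_union_distrib_left, Finset.union_nonempty] at hTS
        exact hTS.resolve_left h1
      rw [Finset.not_nonempty_iff_eq_empty, ← Finset.disjoint_iff_inter_eq_empty] at h1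
      exact half S₂ hS₂ S₁ hS₁ hd.symm (by rw [Finset.union_comm, hu]) T hT h2 h1
  refine ⟨S, hSB, S₁, S₂, hA, ⟨?_, ?_⟩, hSA, hS₁, hS₂, hd, hu⟩
  · intro K hK
    rcases Finset.mem_insert.1 hK with rfl | hK
    · exact hB.nonempty K hSB
    · exact hA.nonempty K hK
  · intro K hK L hL hKL
    rw [Finset.mem_insert] at hK hL ⊢
    rcases hK with rfl | hK <;> rcases hL with rfl | hL
    · simp
    · rw [Finset.inter_comm] at hKL
      rw [Finset.union_comm]
      exact cross L hL hKL
    · exact cross K hK hKL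
    · exact Or.inr (hA.union K hK L hL hKL)

theorem IsSplitInsertion.isFlag {B : Finset (Finset α)} {S S₁ S₂ : Finset α}
    (h : IsSplitInsertion B S S₁ S₂) (hF : IsFlag B) : IsFlag (insert S B) := by
  intro K hK hc
  rcases Finset.mem_insert.1 hK with rfl | hK
  · exact ⟨S₁, Finset.mem_insert_of_mem h.left_mem, S₂, Finset.mem_insert_of_mem h.right_mem,
      h.disjoint, h.union_eq⟩
  · obtain ⟨L, hL, M, hM, hLM⟩ := hF K hK hc
    exact ⟨L, Finset.mem_insert_of_mem hL, M, Finset.mem_insert_of_mem hM, hLM⟩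

theorem signPattern {B : Finset (Finset α)} (hB : IsBuilding B) (hF : IsFlag B) {V : Finset α}
    (hV : ∀ x ∈ V, {x} ∈ B) : SignPattern B V := by
  classical
  -- The family varies because the induction hypothesis is applied to subfamilies of `B` on `S₁` and
  -- `S₂`, and to a contraction on `V \ S`.
  induction hn : V.card using Nat.strong_induction_on generalizing B V with
  | _ n ih =>
    -- A largest flag building subfamily that contains the singletons and has the sign pattern must
    -- be `B`, as otherwise it could be enlarged.
    set 𝓕 := B.powerset.filter fun A =>
      IsBuilding A ∧ IsFlag A ∧ (∀ K ∈ B, K.card = 1 → K ∈ A) ∧ SignPattern A V with h𝓕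
    have h0 : B.filter (fun K => K.card = 1) ∈ 𝓕 := by
      refine Finset.mem_filter.2 ⟨Finset.mem_powerset.2 (Finset.filter_subset _ _),
        ⟨fun K hK => hB.nonempty K (Finset.mem_filter.1 hK).1, ?_⟩, ?_, ?_, ?_⟩
      · intro K hK L hL hKL
        obtain ⟨x, hx⟩ := Finset.card_eq_one.1 (Finset.mem_filter.1 hK).2
        obtain ⟨y, hy⟩ := Finset.card_eq_one.1 (Finset.mem_filter.1 hL).2
        subst hx hy
        obtain ⟨z, hz⟩ := hKL
        simp only [Finset.mem_inter, Finset.mem_singleton] at hz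
        obtain ⟨rfl, rfl⟩ := hz
        rwa [Finset.union_idempotent]
      · intro K hK hc
        have := (Finset.mem_filter.1 hK).2
        omega
      · exact fun K hK hc => Finset.mem_filter.2 ⟨hK, hc⟩
      · exact signPattern_of_card_eq_one (fun K hK => (Finset.mem_filter.1 hK).2)
          fun x hx => Finset.mem_filter.2 ⟨hV x hx, Finset.card_singleton x⟩
    obtain ⟨A, hA, hmax⟩ := Finset.exists_max_image 𝓕 Finset.card ⟨_, h0⟩
    rw [h𝓕, Finset.mem_filter, Finset.mem_powerset] at hA
    obtain ⟨hAB, hAb, hAF, hone, hAs⟩ := hA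
    rcases hAB.eq_or_ssubset with rfl | hss
    · exact hAs
    obtain ⟨S, hSB, S₁, S₂, h⟩ := exists_isSplitInsertion hB hF hAb hss hone
    have hsing : ∀ x ∈ V, {x} ∈ A := fun x hx => hone _ (hV x hx) (Finset.card_singleton x)
    have hc1 := (hAb.nonempty _ h.left_mem).card_pos
    have hc2 := (hAb.nonempty _ h.right_mem).card_pos
    have hc := h.card_eq
    have hsub1 : S₁ ⊆ S := h.union_eq ▸ Finset.subset_union_left
    have hsub2 : S₂ ⊆ S := h.union_eq ▸ Finset.subset_union_right
    have hlt : (insert S A) ∈ 𝓕 := by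
      refine Finset.mem_filter.2 ⟨Finset.mem_powerset.2 (Finset.insert_subset hSB hAB),
        h.building_insert, h.isFlag hAF,
        fun K hK hc => Finset.mem_insert_of_mem (hone K hK hc), h.signPattern hAs ?_ ?_ ?_⟩
      · intro hSV
        have := Finset.card_le_card hSV
        exact ih _ (by omega) hAb hAF (fun x hx => hsing x (hSV (hsub1 hx))) rfl
      · intro hSV
        have := Finset.card_le_card hSV
        exact ih _ (by omega) hAb hAF (fun x hx => hsing x (hSV (hsub2 hx))) rfl
      · intro hSV
        have := Finset.card_sdiff_add_card_eq_card hSV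
        refine ih _ (by omega) (h.building_insert.contract S)
          ((h.isFlag hAF).contract h.building_insert S) (fun x hx => ?_) rfl
        rw [Finset.mem_sdiff] at hx
        refine mem_contract.2 ⟨{x}, Finset.mem_insert_of_mem (hsing x hx.1), ?_, ?_⟩
        · simpa using hx.2
        · exact Finset.sdiff_eq_self_of_disjoint (by simpa using hx.2)
    have := hmax _ hlt
    rw [Finset.card_insert_of_notMem h.notMem] at this
    omega

/-! ### From even numbers to odd numbers. -/

/-- Möbius inversion on subsets: after exchanging the sums, the signs over all `J` between `L` and
`I` cancel unless `L = I`. -/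
theorem sum_neg_one_pow_card_mul_sum_powerset (f : Finset α → ℤ) (I : Finset α) :
    ∑ J ∈ I.powerset, (-1) ^ J.card * ∑ L ∈ J.powerset, f L = (-1) ^ I.card * f I := by
  have h1 : ∀ J ∈ I.powerset, (-1) ^ J.card * ∑ L ∈ J.powerset, f L =
      ∑ L ∈ I.powerset, if L ⊆ J then (-1) ^ ((J \ L).card + L.card) * f L else 0 := by
    intro J hJ
    rw [← Finset.sum_filter, Finset.mul_sum]
    have : I.powerset.filter (fun L => L ⊆ J) = J.powerset := by
      ext L
      simp only [Finset.mem_filter, Finset.mem_powerset, and_iff_right_iff_imp]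
      exact fun h => h.trans (Finset.mem_powerset.1 hJ)
    rw [this]
    refine Finset.sum_congr rfl fun L hL => ?_
    rw [Finset.card_sdiff_add_card_eq_card (Finset.mem_powerset.1 hL)]
  rw [Finset.sum_congr rfl h1, Finset.sum_comm, Finset.sum_eq_single_of_mem I
    (Finset.mem_powerset_self I)]
  · rw [sum_powerset_superset subset_rfl fun X => (-1) ^ (X.card + I.card) * f I]
    simp
  · intro L hL hne
    have hLI := Finset.mem_powerset.1 hL
    rw [sum_powerset_superset hLI fun X => (-1) ^ (X.card + L.card) * f L]
    simp_rw [pow_add, mul_assoc]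
    rw [← Finset.sum_mul, Finset.sum_powerset_neg_one_pow_card_of_nonempty, zero_mul]
    exact Finset.sdiff_nonempty.2 fun h => hne (hLI.antisymm h)

/-- The left side solves the odd recursion: an even component contributes a zero factor to `altSum`,
and for nonempty odd `I` inversion leaves the even number of `I`, which is 0 because `I` has an odd
component. -/
theorem altNumber_oddOn {B : Finset (Finset α)} (hB : IsBuilding B) {V : Finset α}
    (hV : ∀ x ∈ V, {x} ∈ B) :
    ∀ I ⊆ V, (-1) ^ I.card * altSum (EvenOn B) I = altNumber (OddOn B) I := by
  refine eq_altNumber ?_ ?_ ?_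
  · simp [altSum_empty]
  · intro I hI _ hO
    unfold OddOn at hO
    push Not at hO
    obtain ⟨K, hK, hKe⟩ := hO
    rw [← Finset.union_sdiff_of_subset hK.1.2, (hK.separated hB).altSum_union hB,
      altSum_eq_zero (hB.nonempty K hK.1.1).ne_empty ((evenOn_of_mem hK.1.1).2
        (Nat.not_odd_iff_even.1 hKe))]
    ring
  · intro I hI h0 hO
    rw [show ∑ J ∈ I.powerset, (-1) ^ J.card * altSum (EvenOn B) J = _ from
      sum_neg_one_pow_card_mul_sum_powerset (altNumber (EvenOn B)) I,
      altNumber_of_not h0, mul_zero]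
    intro hE
    obtain ⟨x, hx⟩ := Finset.nonempty_iff_ne_empty.2 h0
    obtain ⟨K, hK, _⟩ := exists_isComp_superset (hV x (hI hx)) (Finset.singleton_subset_iff.2 hx)
    exact Nat.not_even_iff_odd.2 (hO K hK) (hE K hK)

open Classical in
/-- The maximal members of `B` inside `I`. -/
noncomputable def comps (B : Finset (Finset α)) (I : Finset α) : Finset (Finset α) :=
  B.filter (IsComp B I)

omit [DecidableEq α] in
theorem mem_comps {B : Finset (Finset α)} {I K : Finset α} : K ∈ comps B I ↔ IsComp B I K := by
  classical exact Finset.mem_filter.trans (and_iff_right_of_imp fun h => h.1.1)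

theorem disjoint_of_isComp {B : Finset (Finset α)} (hB : IsBuilding B) {I K L : Finset α}
    (hK : IsComp B I K) (hL : IsComp B I L) (hne : K ≠ L) : Disjoint K L := by
  rw [Finset.disjoint_iff_inter_eq_empty, ← Finset.not_nonempty_iff_eq_empty]
  intro h
  exact hne ((hL.subset_of_inter hB hK.1.1 hK.1.2 (by rwa [Finset.inter_comm])).antisymm
    (hK.subset_of_inter hB hL.1.1 hL.1.2 h))

theorem biUnion_comps {B : Finset (Finset α)} {I : Finset α} (hI : ∀ x ∈ I, {x} ∈ B) :
    (comps B I).biUnion id = I := by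
  refine (Finset.biUnion_subset.2 fun K hK => (mem_comps.1 hK).1.2).antisymm fun x hx => ?_
  obtain ⟨K, hK, hxK⟩ := exists_isComp_superset (hI x hx) (Finset.singleton_subset_iff.2 hx)
  exact Finset.mem_biUnion.2 ⟨K, mem_comps.2 hK, Finset.singleton_subset_iff.1 hxK⟩

theorem altSum_eq_prod {B : Finset (Finset α)} (hB : IsBuilding B) {I : Finset α}
    (hI : ∀ x ∈ I, {x} ∈ B) :
    altSum (EvenOn B) I = ∏ K ∈ comps B I, altSum (EvenOn B) K := by
  suffices H : ∀ T ⊆ comps B I,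
      altSum (EvenOn B) (T.biUnion id) = ∏ K ∈ T, altSum (EvenOn B) K by
    rw [← H _ subset_rfl, biUnion_comps hI]
  intro T
  induction T using Finset.induction_on with
  | empty => simp [altSum_empty]
  | insert K T hKT ih =>
    intro hT
    rw [Finset.insert_subset_iff] at hT
    have hK := mem_comps.1 hT.1
    have hsep : Separated B K (T.biUnion id) := by
      refine (hK.separated hB).mono subset_rfl (Finset.biUnion_subset.2 fun L hL => ?_)
      have hLc := mem_comps.1 (hT.2 hL)
      refine Finset.subset_sdiff.2 ⟨hLc.1.2, disjoint_of_isComp hB hLc hK ?_⟩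
      rintro rfl
      exact hKT hL
    rw [Finset.biUnion_insert, Finset.prod_insert hKT, ← ih hT.2]
    exact hsep.altSum_union hB

theorem card_eq_sum_comps {B : Finset (Finset α)} (hB : IsBuilding B) {I : Finset α}
    (hI : ∀ x ∈ I, {x} ∈ B) : I.card = ∑ K ∈ comps B I, K.card := by
  conv_lhs => rw [← biUnion_comps hI]
  exact Finset.card_biUnion fun K hK L hL hne =>
    disjoint_of_isComp hB (mem_comps.1 hK) (mem_comps.1 hL) hne

theorem altNumber_oddOn_nonneg {B : Finset (Finset α)} (hB : IsBuilding B) (hF : IsFlag B)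
    {I : Finset α} (hI : ∀ x ∈ I, {x} ∈ B) (hO : OddOn B I) :
    0 ≤ (-1) ^ ((I.card + (comps B I).card) / 2) * altNumber (OddOn B) I := by
  have hcard : I.card = 2 * ∑ K ∈ comps B I, K.card / 2 + (comps B I).card := by
    rw [card_eq_sum_comps hB hI, Finset.mul_sum, Finset.card_eq_sum_ones,
      ← Finset.sum_add_distrib]
    refine Finset.sum_congr rfl fun K hK => ?_
    obtain ⟨k, hk⟩ := hO K (mem_comps.1 hK)
    omega
  have hprod : 0 ≤ ∏ K ∈ comps B I, ((-1) ^ (K.card / 2) * altSum (EvenOn B) K) :=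
    Finset.prod_nonneg fun K hK => (signPattern hB hF fun x hx =>
      hI x ((mem_comps.1 hK).1.2 hx)).altSum_nonneg (mem_comps.1 hK).1.1
  rw [Finset.prod_mul_distrib, Finset.prod_pow_eq_pow_sum, ← altSum_eq_prod hB hI] at hprod
  rw [← altNumber_oddOn hB hI I subset_rfl, ← mul_assoc, ← pow_add]
  set m := ∑ K ∈ comps B I, K.card / 2
  -- By `hcard`, |I| = 2m + c with c components, so the exponent has the parity of m, the sum of the
  -- exponents of the components.
  rw [show (I.card + (comps B I).card) / 2 + I.card = m + 2 * (m + (comps B I).card) by omega,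
    pow_add, pow_mul]
  simpa using hprod

end SetSystem

/-! ### Connected vertex sets of a graph. -/

namespace SimpleGraph

open SetSystem

universe u

open Classical in
/-- The family of vertex sets inducing connected subgraphs. -/
noncomputable def connectedSets {V : Type u} [Fintype V] (G : SimpleGraph V) :
    Finset (Finset V) :=
  Finset.univ.filter fun K => (G.induce (K : Set V)).Connected

variable {V : Type u} [Fintype V] {G : SimpleGraph V}

theorem mem_connectedSets {K : Finset V} :
    K ∈ G.connectedSets ↔ (G.induce (K : Set V)).Connected := by
  simp [connectedSets]

theorem singleton_mem_connectedSets (x : V) : {x} ∈ G.connectedSets := by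
  rw [mem_connectedSets, Finset.coe_singleton]
  have : Subsingleton ({x} : Set V) := Set.subsingleton_singleton.coe_sort
  exact ⟨Preconnected.of_subsingleton⟩

theorem isBuilding_connectedSets [DecidableEq V] : IsBuilding G.connectedSets := by
  constructor
  · intro K hK
    obtain ⟨x⟩ := (mem_connectedSets.1 hK).nonempty
    exact ⟨x.1, x.2⟩
  · intro K hK L hL h
    rw [mem_connectedSets] at hK hL ⊢
    rw [Finset.coe_union]
    refine induce_union_connected hK.preconnected hL.preconnected ?_
    exact_mod_cast h

/-- An embedding of graphs restricts to an isomorphism onto an induced image. -/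
noncomputable def Embedding.induceImageIso {W : Type u} {H : SimpleGraph W} (φ : H ↪g G)
    (s : Set W) : H.induce s ≃g G.induce (φ '' s) where
  toEquiv := Equiv.Set.image φ s φ.injective
  map_rel_iff' := by
    intro a b
    simp

theorem map_mem_connectedSets {W : Type u} {H : SimpleGraph W} (φ : H ↪g G) {s : Finset W} :
    s.map φ.toEmbedding ∈ G.connectedSets ↔ (H.induce (s : Set W)).Connected := by
  rw [mem_connectedSets, (φ.induceImageIso (s : Set W)).connected_iff, Finset.coe_map]
  rfl

/-- Split off a vertex whose deletion leaves the induced subgraph connected. -/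
theorem isFlag_connectedSets [DecidableEq V] : IsFlag G.connectedSets := by
  intro K hK hc
  have hcon := mem_connectedSets.1 hK
  have : Nontrivial (K : Set V) := by
    rw [Set.nontrivial_coe_sort]
    exact_mod_cast Finset.one_lt_card_iff_nontrivial.1 hc
  obtain ⟨v, hv⟩ := hcon.exists_connected_induce_compl_singleton_of_finite_nontrivial
  have hv' : K.erase v.1 ∈ G.connectedSets := by
    rw [mem_connectedSets]
    have e := ((Embedding.induce (G := G) (K : Set V)).induceImageIso {v}ᶜ).connected_iff.1 hv
    have hset : ((K.erase v.1 : Finset V) : Set V) =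
        Embedding.induce (G := G) (K : Set V) '' {v}ᶜ := by
      ext x
      simp only [Finset.coe_erase, Set.mem_sdiff, Set.mem_singleton_iff, Set.mem_image]
      constructor
      · rintro ⟨h1, h2⟩
        exact ⟨⟨x, h1⟩, fun h => h2 (congrArg Subtype.val h), rfl⟩
      · rintro ⟨y, hy, rfl⟩
        exact ⟨y.2, fun h => hy (Subtype.ext h)⟩
    rwa [hset]
  refine ⟨{v.1}, singleton_mem_connectedSets _, _, hv', ?_, ?_⟩
  · simp
  · rw [← Finset.insert_eq, Finset.insert_erase v.2]

/-! ### Translating the graph recursions into set recursions. -/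

theorem isComp_map_iff {W : Type u} [Fintype W] {H : SimpleGraph W} (φ : H ↪g G)
    {s : Finset W} :
    IsComp G.connectedSets (Finset.univ.map φ.toEmbedding) (s.map φ.toEmbedding) ↔
      ∃ C : H.ConnectedComponent, C.supp = (s : Set W) := by
  rw [← ConnectedComponent.maximal_connected_induce_iff]
  constructor
  · intro h
    refine ⟨(map_mem_connectedSets φ).1 h.1.1, fun t ht hst => ?_⟩
    classical
    have h1 := h.2 (y := t.toFinset.map φ.toEmbedding)
      ⟨(map_mem_connectedSets φ).2 (by rwa [Set.coe_toFinset]),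
        Finset.map_subset_map.2 (Finset.subset_univ _)⟩
      (Finset.map_subset_map.2 fun x hx => Set.mem_toFinset.2 (hst hx))
    have h2 := Finset.map_subset_map.1 h1
    exact fun x hx => h2 (Set.mem_toFinset.2 hx)
  · intro h
    refine ⟨⟨(map_mem_connectedSets φ).2 h.1,
      Finset.map_subset_map.2 (Finset.subset_univ _)⟩, ?_⟩
    rintro t ⟨ht, htu⟩ hst
    obtain ⟨t, _, rfl⟩ := Finset.subset_map_iff.1 htu
    rw [map_mem_connectedSets] at ht
    have h1 := Finset.map_subset_map.1 hst
    exact Finset.map_subset_map.2 (Finset.coe_subset.1 (h.2 ht (Finset.coe_subset.2 h1)))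

theorem forall_ncard_supp_iff {W : Type u} [Fintype W] {H : SimpleGraph W} (φ : H ↪g G)
    (P : ℕ → Prop) : (∀ C : H.ConnectedComponent, P C.supp.ncard) ↔
      ∀ K, IsComp G.connectedSets (Finset.univ.map φ.toEmbedding) K → P K.card := by
  constructor
  · intro h K hK
    obtain ⟨s, _, rfl⟩ := Finset.subset_map_iff.1 hK.1.2
    obtain ⟨C, hC⟩ := (isComp_map_iff φ).1 hK
    have := h C
    rwa [hC, Set.ncard_coe_finset, ← Finset.card_map φ.toEmbedding] at this
  · intro h C
    classical
    have := h (C.supp.toFinset.map φ.toEmbedding) ((isComp_map_iff φ).2 ⟨C, by simp⟩)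
    rwa [Finset.card_map, ← Set.ncard_eq_toFinset_card'] at this

omit [Fintype V] in
open Classical in
/-- A graph number defined by the alternating recursion is the number attached to the set of
vertices of an embedded copy. -/
theorem eq_altNumber_map {F : ∀ (W : Type u) [Fintype W], SimpleGraph W → ℤ}
    {P : ∀ W : Type u, SimpleGraph W → Prop} {E : Finset V → Prop}
    (hF : ∀ (W : Type u) [Fintype W] (H : SimpleGraph W), F W H =
      if IsEmpty W then 1
      else if ¬ P W H then 0
      else -∑ I : {I : Finset W // I ⊂ Finset.univ}, F _ (H.induce (I.1 : Set W)))
    (hP : ∀ (W : Type u) [Fintype W] (H : SimpleGraph W) (φ : H ↪g G),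
      P W H ↔ E (Finset.univ.map φ.toEmbedding))
    (W : Type u) [Fintype W] (H : SimpleGraph W) (φ : H ↪g G) :
    F W H = altNumber E (Finset.univ.map φ.toEmbedding) := by
  induction hn : Fintype.card W using Nat.strong_induction_on generalizing W with
  | _ n ih =>
    rw [hF]
    split_ifs with h1 h2
    · rw [Finset.univ_eq_empty, Finset.map_empty, altNumber_empty]
    · have h0 : (Finset.univ.map φ.toEmbedding) ≠ ∅ := by
        rw [not_isEmpty_iff] at h1
        simpa using Finset.univ_nonempty.ne_empty
      rw [altNumber_of h0 ((hP W H φ).1 h2)]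
      congr 1
      refine Finset.sum_bij (fun I _ => I.1.map φ.toEmbedding) ?_ ?_ ?_ ?_
      · intro I _
        rw [Finset.mem_ssubsets]
        exact Finset.map_ssubset_map.2 I.2
      · intro I _ J _ h
        exact Subtype.ext (Finset.map_injective _ h)
      · intro J hJ
        rw [Finset.mem_ssubsets] at hJ
        obtain ⟨I, _, rfl⟩ := Finset.subset_map_iff.1 hJ.1
        exact ⟨⟨I, Finset.map_ssubset_map.1 hJ⟩, Finset.mem_univ _, rfl⟩
      -- The vertex type changes at each level of the recursion; composing embeddings keeps every
      -- level inside the fixed `V`.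
      · intro I _
        rw [ih _ (hn ▸ card_coe_lt_of_ssubset_univ I.1 I.2) _ _
          (φ.comp (Embedding.induce (I.1 : Set W))) rfl]
        congr 1
        ext x
        simp
    · have h0 : (Finset.univ.map φ.toEmbedding) ≠ ∅ := by
        rw [not_isEmpty_iff] at h1
        simpa using Finset.univ_nonempty.ne_empty
      rw [altNumber_of_not h0 (mt (hP W H φ).2 h2)]

theorem univ_map_refl : Finset.univ.map (Embedding.refl (G := G)).toEmbedding = Finset.univ := by
  ext x
  simp

theorem aNumber_eq_altNumber [DecidableEq V] (G : SimpleGraph V) :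
    G.aNumber = altNumber (EvenOn G.connectedSets) Finset.univ := by
  have := eq_altNumber_map (G := G) (F := fun W _ H => H.aNumber)
    (P := fun W H => H.AllComponentsEven) (E := EvenOn G.connectedSets)
    (fun W _ H => by rw [aNumber]) (fun W _ H φ => forall_ncard_supp_iff φ Even) V G
    (Embedding.refl)
  rw [this, univ_map_refl]
  congr!

theorem bNumber_eq_altNumber [DecidableEq V] (G : SimpleGraph V) :
    G.bNumber = altNumber (OddOn G.connectedSets) Finset.univ := by
  have := eq_altNumber_map (G := G) (F := fun W _ H => H.bNumber)
    (P := fun W H => H.AllComponentsOdd) (E := OddOn G.connectedSets)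
    (fun W _ H => by rw [bNumber]) (fun W _ H φ => forall_ncard_supp_iff φ Odd) V G
    (Embedding.refl)
  rw [this, univ_map_refl]
  congr!

theorem numComponents_eq_card_comps (G : SimpleGraph V) :
    G.numComponents = (comps G.connectedSets Finset.univ).card := by
  classical
  rw [numComponents, Nat.card_eq_fintype_card, ← Finset.card_univ]
  have hc (s : Finset V) : IsComp G.connectedSets Finset.univ s ↔
      ∃ C : G.ConnectedComponent, C.supp = (s : Set V) := by
    have := isComp_map_iff (G := G) Embedding.refl (s := s)
    rwa [univ_map_refl, show s.map (Embedding.refl (G := G)).toEmbedding = s by ext; simp] at this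
  refine Finset.card_bij (fun C _ => C.supp.toFinset) ?_ ?_ ?_
  · intro C _
    exact mem_comps.2 ((hc _).2 ⟨C, by simp⟩)
  · intro C _ D _ h
    exact ConnectedComponent.supp_injective (Set.toFinset_inj.1 h)
  · intro s hs
    obtain ⟨C, hC⟩ := (hc s).1 (mem_comps.1 hs)
    exact ⟨C, Finset.mem_univ _, by simp [hC]⟩

end SimpleGraph

/-! ### The sign theorem. -/

theorem eq_neg_one_pow_mul_abs {n : ℕ} {x : ℤ} (h : 0 ≤ (-1) ^ n * x) :
    x = (-1) ^ n * |x| := by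
  rcases neg_one_pow_eq_or ℤ n with e | e <;> rw [e] at h ⊢
  · rw [abs_of_nonneg (by linarith)]; ring
  · rw [abs_of_nonpos (by linarith)]; ring

theorem mainTheorem6 {V : Type*} [Fintype V] (G : SimpleGraph V) :
    (G.AllComponentsEven →
      G.aNumber = (-1 : ℤ) ^ (Fintype.card V / 2) * |G.aNumber|) ∧
    (G.AllComponentsOdd →
      G.bNumber = (-1 : ℤ) ^ ((Fintype.card V + G.numComponents) / 2) * |G.bNumber|) := by
  classical
  constructor
  · intro _
    refine eq_neg_one_pow_mul_abs ?_
    rw [G.aNumber_eq_altNumber]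
    exact (SetSystem.signPattern SimpleGraph.isBuilding_connectedSets
      SimpleGraph.isFlag_connectedSets
      fun x _ => SimpleGraph.singleton_mem_connectedSets x).altNumber_nonneg
  · intro hO
    refine eq_neg_one_pow_mul_abs ?_
    rw [G.bNumber_eq_altNumber, G.numComponents_eq_card_comps]
    refine SetSystem.altNumber_oddOn_nonneg SimpleGraph.isBuilding_connectedSets
      SimpleGraph.isFlag_connectedSets
      (fun x _ => SimpleGraph.singleton_mem_connectedSets x) ?_
    have := (SimpleGraph.forall_ncard_supp_iff (SimpleGraph.Embedding.refl (G := G)) Odd).1 hO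
    rwa [SimpleGraph.univ_map_refl] at this
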